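/- Let $(W,S)$ be a Coxeter system with $S$ finite and Coxeter matrix $(m(s,t))$, and let $\Gamma$ be its Coxeter graph: $s\ne t$ are joined by an edge iff $m(s,t)\ge 3$ (possibly $m(s,t)=\infty$). Let $f$ assign to each directed edge $(s,t)$ of $\Gamma$ a nonzero complex number $f_{s,t}$ with $f_{s,t}=f_{t,s}^{-1}$, and suppose that $f$ is balanced: for every closed path in $\Gamma$ the product of the weights $f$ of its successive directed edges is $1$. Let complex numbers $k_{s,t}$, for the directed edges $(s,t)$, satisfy $k_{s,t}k_{t,s}=4\cos^2(\pi/m(s,t))$ if $m(s,t)<\infty$ and $k_{s,t}k_{t,s}\in[4,\infty)$ if $m(s,t)=\infty$, and suppose that $k_{s,t}=f_{s,t}\ell_{s,t}$ with real numbers $\ell_{s,t}>0$. Choose an origin in each connected component of $\Gamma$, let $\mathrm{wt}(s)$ be the product of the weights $f$ along any path from $s$ to the origin of its component (so $\mathrm{wt}=1$ at each origin and $f_{s,t}=\mathrm{wt}(s)/\mathrm{wt}(t)$ on every edge), and let $J=\mathrm{diag}(\mathrm{wt}(s))_{s\in S}$. A position is a vector $p\in\mathbb C^{S}$. Firing $s\in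 S$ replaces $p_s$ by $-p_s$, adds $k_{s,t}p_s$ to $p_t$ for each neighbour $t$ of $s$, and leaves the other coordinates unchanged. The firing of $s$ in $p$ is pseudo-positive if $\mathrm{wt}(s)p_s$ is a positive real number. A play sequence is a finite word $s_1s_2\cdots s_r$ in $S$ ($r\ge 0$); it is played by firing $s_1$ first, then $s_2$, and so on, the position reached from $p$ is denoted $p^{s_1\cdots s_r}$, and the play sequence is pseudo-positive (from $p$) if each of its firings is pseudo-positive in the position in which it is made. Let $\tilde{\mathcal P}_p$ be the set of all positions $p^{s_1\cdots s_r}$. Let $p\in\mathbb C^{S}$ be a position such that every coordinate of $Jp$ is a positive real number. Then: 1. For any two play sequences, $p^{s_1\cdots s_r}=p^{s'_1\cdots s'_q}$ if and only if $s_1\cdots s_r=s'_1\cdots s'_q$ as elements of $W$. 2. The induced map $w\mapsto p^w$ (where $p^w=p^{s_1\cdots s_r}$ for any word with $w=s_1\cdots s_r$ in $W$) is a bijection $W\to\tilde{\mathcal P}_p$. 3. For every $w\in W$, the right descent set $D_R(w)=\{s\in S:\ \mathrm{length}(ws)<\mathrm{length}(w)\}$ equals the set of those $s\in S$ for which the $s$-coordinate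 of $Jp^w$ is a negative real number. 4. A play sequence $s_1\cdots s_r$ is pseudo-positive from $p$ if and only if $s_1\cdots s_r$ is a reduced word. -/

import Mathlib

namespace WeightedCoxeter

/-- The Coxeter graph of a Coxeter matrix: distinct vertices `s`, `t` are joined by an edge exactly
when `m(s,t) ≠ 2`, that is `3 ≤ m(s,t) ≤ ∞` (Mathlib encodes `m(s,t) = ∞` as `M s t = 0`). -/
def coxeterGraph {S : Type*} (M : CoxeterMatrix S) : SimpleGraph S where
  Adj s t := s ≠ t ∧ M s t ≠ 2
  symm := ⟨fun s t h => ⟨h.1.symm, by rw [M.symmetric t s]; exact h.2⟩⟩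
  loopless := ⟨fun _ h => h.1 rfl⟩

/-- A legal weight function: a nonzero complex number for every directed edge, with
`f(s,t) = f(t,s)⁻¹`. The values off the edges play no role. -/
structure LegalWeight {S : Type*} (M : CoxeterMatrix S) where
  toFun : S → S → ℂ
  ne_zero : ∀ s t, (coxeterGraph M).Adj s t → toFun s t ≠ 0
  eq_inv : ∀ s t, (coxeterGraph M).Adj s t → toFun s t = (toFun t s)⁻¹

/-- The weight of a path (walk) in a weighted Coxeter graph: the product of the weights of the
directed edges that it traverses. -/
def walkWeight {S : Type*} {M : CoxeterMatrix S} (f : LegalWeight M) :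
    {s t : S} → (coxeterGraph M).Walk s t → ℂ
  | _, _, .nil => 1
  | _, _, .cons (u := u) (v := v) _ q => f.toFun u v * walkWeight f q

/-- A weighted Coxeter graph is balanced if every closed path has weight `1`. -/
def IsBalanced {S : Type*} {M : CoxeterMatrix S} (f : LegalWeight M) : Prop :=
  ∀ (s : S) (q : (coxeterGraph M).Walk s s), walkWeight f q = 1

/-- A choice of an origin in each connected component of the Coxeter graph (so, for a connected
nonempty graph, a choice of one vertex). -/
structure Origins {S : Type*} (M : CoxeterMatrix S) where
  origin : (coxeterGraph M).ConnectedComponent → S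
  origin_mem : ∀ c, (coxeterGraph M).connectedComponentMk (origin c) = c

theorem Origins.reachable {S : Type*} {M : CoxeterMatrix S} (o : Origins M) (s : S) :
    (coxeterGraph M).Reachable s (o.origin ((coxeterGraph M).connectedComponentMk s)) :=
  SimpleGraph.ConnectedComponent.exact (o.origin_mem _).symm

/-- The weight `wt(s)` of a vertex: the weight of a path joining `s` to the origin of its component.
It is `1` at the origin, it does not depend on the path if the graph is balanced
(`vertexWeight_eq`), and the weight of an edge is then the ratio of the weights of its ends,
`f(s,t) = wt(s) / wt(t)` (`vertexWeight_eq_mul`). -/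
noncomputable def vertexWeight {S : Type*} {M : CoxeterMatrix S} (f : LegalWeight M)
    (o : Origins M) (s : S) : ℂ :=
  walkWeight f (Classical.choice (o.reachable s))

theorem walkWeight_append {S : Type*} {M : CoxeterMatrix S} (f : LegalWeight M) {s t u : S}
    (q : (coxeterGraph M).Walk s t) (r : (coxeterGraph M).Walk t u) :
    walkWeight f (q.append r) = walkWeight f q * walkWeight f r := by
  induction q with
  | nil => simp [walkWeight]
  | cons h q ih => simp [walkWeight, ih, mul_assoc]

theorem walkWeight_eq_of_isBalanced {S : Type*} {M : CoxeterMatrix S} {f : LegalWeight M}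
    (hf : IsBalanced f) {s t : S} (q r : (coxeterGraph M).Walk s t) :
    walkWeight f q = walkWeight f r := by
  have hq := hf _ (q.append r.reverse)
  have hr := hf _ (r.append r.reverse)
  rw [walkWeight_append] at hq hr
  have h0 : walkWeight f r.reverse ≠ 0 := fun h => by simp [h] at hr
  exact mul_right_cancel₀ h0 (hq.trans hr.symm)

theorem vertexWeight_eq {S : Type*} {M : CoxeterMatrix S} {f : LegalWeight M}
    (hf : IsBalanced f) (o : Origins M) (s : S)
    (q : (coxeterGraph M).Walk s (o.origin ((coxeterGraph M).connectedComponentMk s))) :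
    vertexWeight f o s = walkWeight f q :=
  walkWeight_eq_of_isBalanced hf _ _

theorem vertexWeight_eq_mul {S : Type*} {M : CoxeterMatrix S} {f : LegalWeight M}
    (hf : IsBalanced f) (o : Origins M) {s t : S} (h : (coxeterGraph M).Adj s t) :
    vertexWeight f o s = f.toFun s t * vertexWeight f o t := by
  have hc : (coxeterGraph M).connectedComponentMk t = (coxeterGraph M).connectedComponentMk s :=
    (SimpleGraph.ConnectedComponent.sound h.reachable).symm
  have hr : ∃ r : (coxeterGraph M).Walk t (o.origin ((coxeterGraph M).connectedComponentMk s)),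
      walkWeight f r = vertexWeight f o t := by
    rw [← hc]
    exact ⟨_, rfl⟩
  obtain ⟨r, hr⟩ := hr
  rw [vertexWeight_eq hf o s (.cons h r), walkWeight, hr]

/-- The diagonal matrix `J` whose diagonal entries are the weights of the vertices. -/
noncomputable def weightMatrix {S : Type*} [DecidableEq S] {M : CoxeterMatrix S}
    (f : LegalWeight M) (o : Origins M) : Matrix S S ℂ :=
  Matrix.diagonal (vertexWeight f o)

/-- The condition on the complex edge weights `k(s,t)` of the numbers game:
`k(s,t) k(t,s) = 4 cos² (π / m(s,t))` if `m(s,t) < ∞`, and `k(s,t) k(t,s)` is a real number `≥ 4`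
if `m(s,t) = ∞`, for all edges. -/
def IsGameWeight {S : Type*} (M : CoxeterMatrix S) (k : S → S → ℂ) : Prop :=
  ∀ s t, (coxeterGraph M).Adj s t →
    (M s t ≠ 0 → k s t * k t s = ((4 * Real.cos (Real.pi / (M s t : ℝ)) ^ 2 : ℝ) : ℂ)) ∧
    (M s t = 0 → ∃ r : ℝ, 4 ≤ r ∧ k s t * k t s = (r : ℂ))

/-- On every edge, `k(s,t) = f(s,t) ℓ(s,t)` with `ℓ(s,t)` a positive real number. -/
def IsDecomposition {S : Type*} {M : CoxeterMatrix S} (k : S → S → ℂ) (f : LegalWeight M)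
    (l : S → S → ℝ) : Prop :=
  ∀ s t, (coxeterGraph M).Adj s t → 0 < l s t ∧ k s t = f.toFun s t * (l s t : ℂ)

open Classical in
/-- Firing the node `s` in the position `p`: switch the sign of `p s`, add `k(s,t) p(s)` to the value
at each neighbour `t` of `s`, and leave the other values unchanged. -/
noncomputable def fire {S : Type*} (M : CoxeterMatrix S) (k : S → S → ℂ) (p : S → ℂ) (s : S) :
    S → ℂ := fun t =>
  if t = s then -p s
  else if (coxeterGraph M).Adj s t then p t + k s t * p s
  else p t

/-- The position reached from `p` by a play sequence; the first letter of the word is fired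
first. -/
noncomputable def play {S : Type*} (M : CoxeterMatrix S) (k : S → S → ℂ) (p : S → ℂ)
    (word : List S) : S → ℂ :=
  word.foldl (fire M k) p

/-- The set of all positions that can be reached from `p` (by arbitrary play sequences). -/
def reachablePositions {S : Type*} (M : CoxeterMatrix S) (k : S → S → ℂ) (p : S → ℂ) :
    Set (S → ℂ) :=
  {q | ∃ word : List S, q = play M k p word}

/-- `z` is a positive real number. -/
def IsPosReal (z : ℂ) : Prop := ∃ r : ℝ, 0 < r ∧ z = (r : ℂ)

/-- `z` is a negative real number. -/
def IsNegReal (z : ℂ) : Prop := ∃ r : ℝ, r < 0 ∧ z = (r : ℂ)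

/-- A play sequence is pseudo-positive from `p` if every move is pseudo-positive in the position in
which it is made: `wt(s)` times the value at the fired node `s` is a positive real number. -/
def IsPseudoPositive {S : Type*} {M : CoxeterMatrix S} (k : S → S → ℂ) (f : LegalWeight M)
    (o : Origins M) : (S → ℂ) → List S → Prop
  | _, [] => True
  | p, s :: word =>
      IsPosReal (vertexWeight f o s * p s) ∧ IsPseudoPositive k f o (fire M k p s) word

end WeightedCoxeter

/-! Balance makes `f` a coboundary, so passing from `p` to `J p` replaces the weights `k` by the
positive reals `l` (`fire_unscale`). It remains to study a real game from a strictly positive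
position `q`. Firing moves are involutions satisfying the braid relations, so `W` acts on positions
(`isLiftable_firePerm`). The crux is a sign rule: the `s`-coordinate of `q^w` is negative exactly
when `s` is a right descent of `w`. It is proved by induction on length. If `s` is not a descent and
`w ≠ 1`, pick a descent `t` and split off the `⟨s,t⟩`-part of `w` (`exists_eq_mul_alternatingWord`).
The shorter factor has positive `s`- and `t`-coordinates, and a rank-two computation finishes
(`foldl_alternatingWord_pos`). The sign rule gives injectivity, since a nontrivial element has a
descent and so cannot fix `q`, and it makes the positive moves exactly those that lengthen the word.
-/

namespace WeightedCoxeter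

open CoxeterSystem

/-! ### The real numbers game and the action of `W`. -/

section RealGame

variable {S W : Type*} [Group W] {M : CoxeterMatrix S}

/-- A real matrix whose rows are the moves of a numbers game on the Coxeter graph of `M`. For
`s ≠ t` the rescaled `2 × 2` block is symmetric with off-diagonal entry `c = 2 cos (π / m(s,t))`,
or `c ≥ 2` if `m(s,t) = ∞`. -/
structure IsMoveMatrix (M : CoxeterMatrix S) (C : S → S → ℝ) : Prop where
  diag : ∀ s, C s s = -2
  exists_scale : ∀ s t, s ≠ t → ∃ a b c : ℝ, 0 < a ∧ 0 < b ∧ C s t * b = c * a ∧ C t s * a = c * b ∧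
    (M s t ≠ 0 → c = 2 * Real.cos (Real.pi / M s t)) ∧ (M s t = 0 → 2 ≤ c)

/-- Firing `s` adds `q s` times the row `C s` to the position `q`. -/
def realFire (C : S → S → ℝ) (s : S) (q : S → ℝ) : S → ℝ := fun u => q u + q s * C s u

variable {C : S → S → ℝ}

theorem IsMoveMatrix.realFire_self (hC : IsMoveMatrix M C) (s : S) (q : S → ℝ) :
    realFire C s q s = -q s := by
  simp only [realFire, hC.diag]; ring

theorem IsMoveMatrix.realFire_involutive (hC : IsMoveMatrix M C) (s : S) :
    Function.Involutive (realFire C s) := by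
  intro q
  funext u
  have := hC.realFire_self s q
  simp only [realFire] at this ⊢
  rw [this]; ring

/-- Firing a node, as a permutation of the positions. -/
def firePerm (hC : IsMoveMatrix M C) (s : S) : Equiv.Perm (S → ℝ) :=
  (hC.realFire_involutive s).toPerm

theorem firePerm_apply (hC : IsMoveMatrix M C) (s : S) (q : S → ℝ) :
    firePerm hC s q = realFire C s q := rfl

theorem two_le_of_ne (M : CoxeterMatrix S) {s t : S} (hst : s ≠ t) (hM : M s t ≠ 0) :
    2 ≤ M s t := by
  have := M.off_diagonal s t hst
  lia

theorem sin_pi_div_pos {m : ℕ} (hm : 2 ≤ m) : 0 < Real.sin (Real.pi / m) := by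
  have h2 : (2 : ℝ) ≤ m := by exact_mod_cast hm
  apply Real.sin_pos_of_pos_of_lt_pi
  · have := Real.pi_pos; positivity
  · exact div_lt_self Real.pi_pos (by linarith)

theorem sin_add_add_sin_sub (x y : ℝ) :
    Real.sin (x + y) = 2 * Real.cos y * Real.sin x - Real.sin (x - y) := by
  rw [Real.sin_add, Real.sin_sub]; ring

/-- In the rescaled coordinates `a q_s`, `b q_t`, firing `t` and then `s` is a linear map with
eigenvalues `e^{±2iθ}`; its powers are given by sines. The factor `sin θ` avoids division. -/
theorem firePerm_mul_pow_scaled (hC : IsMoveMatrix M C) {s t : S} {a b θ : ℝ}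
    (hs : C s t * b = 2 * Real.cos θ * a) (ht : C t s * a = 2 * Real.cos θ * b) (q : S → ℝ)
    (n : ℕ) :
    Real.sin θ * (a * ((firePerm hC s * firePerm hC t) ^ n) q s) =
        -(Real.sin (2 * n * θ) * (b * q t) + Real.sin (2 * n * θ - θ) * (a * q s)) ∧
      Real.sin θ * (b * ((firePerm hC s * firePerm hC t) ^ n) q t) =
        Real.sin (2 * n * θ + θ) * (b * q t) + Real.sin (2 * n * θ) * (a * q s) := by
  induction n with
  | zero => constructor <;> simp
  | succ n ih =>
    obtain ⟨h1, h2⟩ := ih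
    rw [pow_succ']
    simp only [Equiv.Perm.mul_apply, firePerm_apply]
    set r := ((firePerm hC s * firePerm hC t) ^ n) q
    have e1 := sin_add_add_sin_sub (2 * n * θ) θ
    have e2 := sin_add_add_sin_sub (2 * n * θ + θ) θ
    have e3 := sin_add_add_sin_sub (2 * n * θ + θ + θ) θ
    have f1 : 2 * ((n + 1 : ℕ) : ℝ) * θ = 2 * n * θ + θ + θ := by push_cast; ring
    rw [f1, e3]
    simp only [add_sub_cancel_right] at e2 e3 ⊢
    rw [e2]
    simp only [realFire, hC.diag]
    constructor
    · linear_combination -h1 - 2 * Real.cos θ * h2 - Real.sin θ * r t * ht +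
        a * q s * e1
    · linear_combination -h2 + 2 * Real.cos θ * h1 + 4 * Real.cos θ ^ 2 * h2 +
        Real.sin θ * (r s + r t * C t s) * hs + 2 * Real.cos θ * Real.sin θ * r t * ht -
        2 * Real.cos θ * a * q s * e1

theorem firePerm_mul_pow_sub (hC : IsMoveMatrix M C) (s t : S) (q : S → ℝ) (n : ℕ) :
    ∃ x y : ℝ, ∀ u, ((firePerm hC s * firePerm hC t) ^ n) q u = q u + x * C s u + y * C t u := by
  induction n with
  | zero => exact ⟨0, 0, fun u => by simp⟩
  | succ n ih =>
    obtain ⟨x, y, h⟩ := ih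
    rw [pow_succ']
    simp only [Equiv.Perm.mul_apply, firePerm_apply]
    set r := ((firePerm hC s * firePerm hC t) ^ n) q
    refine ⟨x + realFire C t r s, y + r t, fun u => ?_⟩
    simp only [realFire, h u]
    ring

theorem isLiftable_firePerm (hC : IsMoveMatrix M C) : M.IsLiftable (firePerm hC) := by
  intro s t
  rcases eq_or_ne s t with rfl | hst
  · rw [M.diagonal, pow_one]
    ext1 q
    exact hC.realFire_involutive s q
  rcases eq_or_ne (M s t) 0 with h0 | h0
  · rw [h0, pow_zero]
  obtain ⟨a, b, c, ha, hb, hs, ht, hc, -⟩ := hC.exists_scale s t hst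
  obtain rfl := hc h0
  have hm := two_le_of_ne M hst h0
  have hsin := sin_pi_div_pos hm
  have hθ : 2 * (M s t : ℝ) * (Real.pi / M s t) = 2 * Real.pi := by
    have : (M s t : ℝ) ≠ 0 := by exact_mod_cast h0
    field_simp
  ext1 q
  obtain ⟨h1, h2⟩ := firePerm_mul_pow_scaled hC hs ht q (M s t)
  obtain ⟨x, y, h⟩ := firePerm_mul_pow_sub hC s t q (M s t)
  rw [hθ] at h1 h2
  simp only [Real.sin_two_pi, Real.sin_two_pi_sub, add_comm (2 * Real.pi), Real.sin_add_two_pi]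
    at h1 h2
  have e1 : ((firePerm hC s * firePerm hC t) ^ M s t) q s = q s := by
    apply mul_left_cancel₀ (mul_pos hsin ha).ne'
    linear_combination h1
  have e2 : ((firePerm hC s * firePerm hC t) ^ M s t) q t = q t := by
    apply mul_left_cancel₀ (mul_pos hsin hb).ne'
    linear_combination h2
  have k1 := h s
  have k2 := h t
  rw [e1, hC.diag] at k1
  rw [e2, hC.diag] at k2
  -- The total change is a combination of rows `s` and `t` vanishing at `s` and `t`. The `2 × 2`
  -- block has determinant `4 sin² θ ≠ 0`, so the combination is trivial and all other coordinates
  -- are fixed too.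
  have hx : x * (4 * Real.sin (Real.pi / M s t) ^ 2) = 0 := by
    have hcc : C s t * C t s = (2 * Real.cos (Real.pi / M s t)) ^ 2 := by
      apply mul_left_cancel₀ (mul_pos ha hb).ne'
      linear_combination C t s * a * hs + 2 * Real.cos (Real.pi / M s t) * a * ht
    linear_combination 2 * k1 + C t s * k2 + x * hcc +
      4 * x * Real.sin_sq_add_cos_sq (Real.pi / M s t)
  have hx0 : x = 0 := by
    rcases mul_eq_zero.1 hx with h | h
    · exact h
    · exact absurd h (by positivity)
  have hy0 : y = 0 := by rw [hx0] at k2; linarith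
  funext u
  rw [h u, hx0, hy0]
  simp

/-- The position reached from `q` by playing any word for `w`. -/
noncomputable def realPos (cs : CoxeterSystem M W) (hC : IsMoveMatrix M C) (q : S → ℝ) (w : W) :
    S → ℝ :=
  cs.lift ⟨firePerm hC, isLiftable_firePerm hC⟩ w⁻¹ q

theorem realPos_one (cs : CoxeterSystem M W) (hC : IsMoveMatrix M C) (q : S → ℝ) :
    realPos cs hC q 1 = q := by
  simp [realPos]

/-- The inverse in `realPos` turns the left action into a right one, so the last letter is fired
last. -/
theorem realPos_mul_simple (cs : CoxeterSystem M W) (hC : IsMoveMatrix M C) (q : S → ℝ) (w : W)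
    (s : S) : realPos cs hC q (w * cs.simple s) = realFire C s (realPos cs hC q w) := by
  simp only [realPos, mul_inv_rev, map_mul, cs.inv_simple, Equiv.Perm.mul_apply]
  rw [cs.lift_apply_simple]
  rfl

theorem realPos_mul_wordProd (cs : CoxeterSystem M W) (hC : IsMoveMatrix M C) (q : S → ℝ) (w : W)
    (ω : List S) : realPos cs hC q (w * cs.wordProd ω) =
      ω.foldl (fun r s => realFire C s r) (realPos cs hC q w) := by
  induction ω generalizing w with
  | nil => simp
  | cons s ω ih => rw [cs.wordProd_cons, ← mul_assoc, ih, realPos_mul_simple, List.foldl_cons]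

theorem realPos_eq_self_of_eq (cs : CoxeterSystem M W) (hC : IsMoveMatrix M C) {q : S → ℝ}
    {w w' : W} (h : realPos cs hC q w = realPos cs hC q w') : realPos cs hC q (w * w'⁻¹) = q := by
  simp only [realPos, mul_inv_rev, inv_inv, map_mul, Equiv.Perm.mul_apply] at h ⊢
  rw [h, ← Equiv.Perm.mul_apply, ← map_mul, mul_inv_cancel, map_one, Equiv.Perm.one_apply]

/-! ### Rank-two reduction. -/

/-- Strip final letters `t, s, t, …` while they are descents; each step swaps the roles of `s` and
`t`. -/
theorem exists_eq_mul_alternatingWord (cs : CoxeterSystem M W) {s t : S} (hst : s ≠ t) {w : W}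
    (hs : ¬cs.IsRightDescent w s) : ∃ (v : W) (j : ℕ),
      w = v * cs.wordProd (alternatingWord s t j) ∧ cs.length w = cs.length v + j ∧
      ¬cs.IsRightDescent v s ∧ ¬cs.IsRightDescent v t ∧ (M s t ≠ 0 → j < M s t) := by
  induction h : cs.length w using Nat.strong_induction_on generalizing w s t with
  | _ n ih =>
  subst h
  by_cases ht : cs.IsRightDescent w t
  · obtain ⟨v, j, hv, hl, hvt, hvs, hj⟩ := ih _ ht hst.symm
      (cs.isRightDescent_iff_not_isRightDescent_mul.1 ht) rfl
    have hw : w = v * cs.wordProd (alternatingWord s t (j + 1)) := by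
      rw [alternatingWord_succ, cs.wordProd_concat, ← mul_assoc, ← hv,
        cs.simple_mul_simple_cancel_right]
    rw [cs.isRightDescent_iff] at ht
    refine ⟨v, j + 1, hw, by lia, hvs, hvt, fun h0 => ?_⟩
    rw [M.symmetric t s] at hj
    by_contra hlt
    -- A full braid word could be rewritten to end in `s`, making `s` a descent of `w`.
    have hjm : j + 1 = M s t := by have := hj h0; lia
    apply hs
    have hb := cs.wordProd_braidWord_eq s t
    rw [braidWord, braidWord, M.symmetric t s, ← hjm, alternatingWord_succ t s,
      cs.wordProd_concat] at hb
    rw [IsRightDescent, hw, hb, ← mul_assoc, cs.simple_mul_simple_cancel_right, mul_assoc, ← hb,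
      ← hw]
    have h1 := cs.length_mul_le v (cs.wordProd (alternatingWord s t j))
    have h2 := cs.length_wordProd_le (alternatingWord s t j)
    rw [length_alternatingWord] at h2
    lia
  · exact ⟨w, 0, by simp [alternatingWord], rfl, hs, ht, fun h0 => Nat.pos_of_ne_zero h0⟩

/-- `x` and `y` are the initial scaled coordinates, in an order depending on the parity of `n`;
leaving them existential absorbs the swap of `s` and `t` in the induction. -/
theorem foldl_alternatingWord_scaled (hC : IsMoveMatrix M C) {s t : S} {a b θ : ℝ}
    (hs : C s t * b = 2 * Real.cos θ * a) (ht : C t s * a = 2 * Real.cos θ * b) {q : S → ℝ}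
    (ha : 0 < a) (hb : 0 < b) (hqs : 0 < q s) (hqt : 0 < q t) (n : ℕ) :
    ∃ x y : ℝ, 0 < x ∧ 0 < y ∧
      Real.sin θ * (a * (alternatingWord s t n).foldl (fun r s => realFire C s r) q s) =
        Real.sin (n * θ + θ) * x + Real.sin (n * θ) * y ∧
      Real.sin θ * (b * (alternatingWord s t n).foldl (fun r s => realFire C s r) q t) =
        -(Real.sin (n * θ) * x + Real.sin (n * θ - θ) * y) := by
  induction n generalizing s t a b with
  | zero =>
    refine ⟨a * q s, b * q t, by positivity, by positivity, ?_, ?_⟩ <;> simp [alternatingWord]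
  | succ n ih =>
    obtain ⟨x, y, hx, hy, h1, h2⟩ := ih ht hs hb ha hqt hqs
    refine ⟨x, y, hx, hy, ?_⟩
    rw [alternatingWord_succ, List.concat_eq_append, List.foldl_append]
    set r := (alternatingWord t s n).foldl (fun r s => realFire C s r) q
    have e1 := sin_add_add_sin_sub (n * θ) θ
    have e2 := sin_add_add_sin_sub (n * θ + θ) θ
    have f1 : ((n + 1 : ℕ) : ℝ) * θ = n * θ + θ := by push_cast; ring
    rw [f1]
    simp only [add_sub_cancel_right] at e2 ⊢
    simp only [List.foldl_cons, List.foldl_nil, realFire, hC.diag]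
    constructor
    · linear_combination h2 + Real.sin θ * r t * ht + 2 * Real.cos θ * h1 - x * e2 - y * e1
    · linear_combination -h1

/-- Positivity of the sum of the scaled coordinates is the extra invariant that `c ≥ 2` preserves.
-/
theorem foldl_alternatingWord_pos_of_infinite (hC : IsMoveMatrix M C) {s t : S} {a b c : ℝ}
    (hs : C s t * b = c * a) (ht : C t s * a = c * b) (hc : 2 ≤ c) {q : S → ℝ}
    (ha : 0 < a) (hb : 0 < b) (hqs : 0 < q s) (hqt : 0 < q t) (n : ℕ) :
    0 < a * (alternatingWord s t n).foldl (fun r s => realFire C s r) q s ∧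
      0 < a * (alternatingWord s t n).foldl (fun r s => realFire C s r) q s +
        b * (alternatingWord s t n).foldl (fun r s => realFire C s r) q t := by
  induction n generalizing s t a b with
  | zero => constructor <;> simp only [alternatingWord, List.foldl_nil] <;> positivity
  | succ n ih =>
    obtain ⟨h1, h2⟩ := ih ht hs hb ha hqt hqs
    rw [alternatingWord_succ, List.concat_eq_append, List.foldl_append]
    set r := (alternatingWord t s n).foldl (fun r s => realFire C s r) q
    simp only [List.foldl_cons, List.foldl_nil, realFire, hC.diag]
    have e : a * (r s + r t * C t s) = a * r s + c * (b * r t) := by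
      linear_combination r t * ht
    have h3 := mul_le_mul_of_nonneg_right hc h1.le
    rw [e]
    constructor <;> linarith

theorem foldl_alternatingWord_pos (hC : IsMoveMatrix M C) {s t : S} (hst : s ≠ t) {q : S → ℝ}
    (hqs : 0 < q s) (hqt : 0 < q t) {n : ℕ} (hn : M s t ≠ 0 → n < M s t) :
    0 < (alternatingWord s t n).foldl (fun r s => realFire C s r) q s := by
  obtain ⟨a, b, c, ha, hb, hs, ht, hc, hc'⟩ := hC.exists_scale s t hst
  rcases eq_or_ne (M s t) 0 with h0 | h0
  · exact pos_of_mul_pos_right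
      (foldl_alternatingWord_pos_of_infinite hC hs ht (hc' h0) ha hb hqs hqt n).1 ha.le
  obtain rfl := hc h0
  have hsin := sin_pi_div_pos (two_le_of_ne M hst h0)
  obtain ⟨x, y, hx, hy, h, -⟩ := foldl_alternatingWord_scaled hC hs ht ha hb hqs hqt n
  have hm : (0 : ℝ) < M s t := by exact_mod_cast Nat.pos_of_ne_zero h0
  have hθ : 0 < Real.pi / M s t := div_pos Real.pi_pos hm
  have hπ : (M s t : ℝ) * (Real.pi / M s t) = Real.pi := by field_simp
  have hle : (n : ℝ) * (Real.pi / M s t) + Real.pi / M s t ≤ Real.pi := by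
    have : (n : ℝ) + 1 ≤ M s t := by exact_mod_cast hn h0
    nlinarith
  have h0n : 0 ≤ (n : ℝ) * (Real.pi / M s t) := by positivity
  have s1 : 0 ≤ Real.sin (n * (Real.pi / M s t) + Real.pi / M s t) :=
    Real.sin_nonneg_of_nonneg_of_le_pi (by linarith) hle
  have s2 : 0 ≤ Real.sin (n * (Real.pi / M s t)) :=
    Real.sin_nonneg_of_nonneg_of_le_pi h0n (by linarith)
  have hpos : 0 < Real.sin (n * (Real.pi / M s t) + Real.pi / M s t) * x +
      Real.sin (n * (Real.pi / M s t)) * y := by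
    -- The two sines never vanish together: the second is zero only for `n = 0`, where the first is
    -- `sin θ`.
    rcases eq_or_lt_of_le h0n with hz | hz
    · rw [← hz, zero_add, Real.sin_zero, zero_mul, add_zero]
      exact mul_pos hsin hx
    · have := Real.sin_pos_of_pos_of_lt_pi hz (by linarith)
      positivity
  rw [← h, ← mul_assoc] at hpos
  exact pos_of_mul_pos_right hpos (mul_pos hsin ha).le

/-! ### Signs of coordinates and descents. -/

theorem realPos_pos_of_not_isRightDescent (cs : CoxeterSystem M W) (hC : IsMoveMatrix M C)
    {q : S → ℝ} (hq : ∀ s, 0 < q s) {w : W} {s : S} (hs : ¬cs.IsRightDescent w s) :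
    0 < realPos cs hC q w s := by
  induction h : cs.length w using Nat.strong_induction_on generalizing w s with
  | _ n ih =>
  subst h
  rcases eq_or_ne w 1 with rfl | hw
  · rw [realPos_one]; exact hq s
  obtain ⟨t, ht⟩ := cs.exists_rightDescent_of_ne_one hw
  have hst : s ≠ t := by rintro rfl; exact hs ht
  obtain ⟨v, j, hv, hl, hvs, hvt, hj⟩ := exists_eq_mul_alternatingWord cs hst hs
  -- If `j = 0` then `v = w`, which has the descent `t`.
  have hlt : cs.length v < cs.length w := by
    rcases Nat.eq_zero_or_pos j with rfl | hj0
    · simp only [alternatingWord, wordProd_nil, mul_one] at hv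
      exact absurd (hv ▸ ht) hvt
    · lia
  rw [hv, realPos_mul_wordProd]
  exact foldl_alternatingWord_pos hC hst (ih _ hlt hvs rfl) (ih _ hlt hvt rfl) hj

theorem realPos_neg_of_isRightDescent (cs : CoxeterSystem M W) (hC : IsMoveMatrix M C)
    {q : S → ℝ} (hq : ∀ s, 0 < q s) {w : W} {s : S} (hs : cs.IsRightDescent w s) :
    realPos cs hC q w s < 0 := by
  have h := realPos_pos_of_not_isRightDescent cs hC hq
    (cs.isRightDescent_iff_not_isRightDescent_mul.1 hs)
  rw [realPos_mul_simple, hC.realFire_self] at h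
  linarith

theorem realPos_neg_iff (cs : CoxeterSystem M W) (hC : IsMoveMatrix M C)
    {q : S → ℝ} (hq : ∀ s, 0 < q s) {w : W} {s : S} :
    realPos cs hC q w s < 0 ↔ cs.IsRightDescent w s := by
  refine ⟨fun h => ?_, realPos_neg_of_isRightDescent cs hC hq⟩
  by_contra hs
  exact lt_asymm h (realPos_pos_of_not_isRightDescent cs hC hq hs)

theorem realPos_pos_iff (cs : CoxeterSystem M W) (hC : IsMoveMatrix M C)
    {q : S → ℝ} (hq : ∀ s, 0 < q s) {w : W} {s : S} :
    0 < realPos cs hC q w s ↔ ¬cs.IsRightDescent w s :=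
  ⟨fun h hs => lt_asymm h (realPos_neg_of_isRightDescent cs hC hq hs),
    realPos_pos_of_not_isRightDescent cs hC hq⟩

theorem realPos_injective (cs : CoxeterSystem M W) (hC : IsMoveMatrix M C)
    {q : S → ℝ} (hq : ∀ s, 0 < q s) : Function.Injective (realPos cs hC q) := by
  intro w w' h
  by_contra hne
  obtain ⟨t, ht⟩ := cs.exists_rightDescent_of_ne_one (w := w * w'⁻¹)
    (fun h1 => hne (mul_inv_eq_one.1 h1))
  have := realPos_neg_of_isRightDescent cs hC hq ht
  rw [realPos_eq_self_of_eq cs hC h] at this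
  exact lt_asymm this (hq t)

end RealGame

/-! ### From complex to real weights. -/

section Transfer

variable {S : Type*} {M : CoxeterMatrix S}

theorem walkWeight_ne_zero (f : LegalWeight M) {s t : S} (q : (coxeterGraph M).Walk s t) :
    walkWeight f q ≠ 0 := by
  induction q with
  | nil => simp [walkWeight]
  | cons h q ih => exact mul_ne_zero (f.ne_zero _ _ h) ih

theorem vertexWeight_ne_zero (f : LegalWeight M) (o : Origins M) (s : S) :
    vertexWeight f o s ≠ 0 :=
  walkWeight_ne_zero f _

open Classical in
/-- The move matrix of the numbers game with positive real edge weights `l`. -/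
noncomputable def moveMatrix (M : CoxeterMatrix S) (l : S → S → ℝ) (s t : S) : ℝ :=
  if t = s then -2 else if (coxeterGraph M).Adj s t then l s t else 0

theorem edgeWeight_mul_symm {k : S → S → ℂ} {f : LegalWeight M} {l : S → S → ℝ}
    (hkfl : IsDecomposition k f l) {s t : S} (h : (coxeterGraph M).Adj s t) :
    k s t * k t s = ((l s t * l t s : ℝ) : ℂ) := by
  rw [(hkfl s t h).2, (hkfl t s h.symm).2, f.eq_inv s t h]
  have := f.ne_zero t s h.symm
  push_cast
  field_simp

theorem isMoveMatrix_moveMatrix {k : S → S → ℂ} {f : LegalWeight M} {l : S → S → ℝ}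
    (hk : IsGameWeight M k) (hkfl : IsDecomposition k f l) :
    IsMoveMatrix M (moveMatrix M l) where
  diag s := by simp [moveMatrix]
  exists_scale s t hst := by
    by_cases h : (coxeterGraph M).Adj s t
    · have h1 := (hkfl s t h).1
      have h2 := (hkfl t s h.symm).1
      have hkl := edgeWeight_mul_symm hkfl h
      have e1 : moveMatrix M l s t = l s t := by simp [moveMatrix, hst.symm, h]
      have e2 : moveMatrix M l t s = l t s := by simp [moveMatrix, hst, h.symm]
      rw [e1, e2]
      rcases eq_or_ne (M s t) 0 with h0 | h0
      · obtain ⟨r, hr, hrk⟩ := (hk s t h).2 h0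
        have hr' : l s t * l t s = r := by rw [hkl] at hrk; exact_mod_cast hrk
        have hc : 2 ≤ √r := Real.le_sqrt_of_sq_le (by linarith)
        have hsq : √r * √r = r := Real.mul_self_sqrt (by linarith)
        -- Only the ratio `a : b` matters, and `a / b = l s t / c` with `c² = l s t * l t s`
        -- symmetrizes the block.
        exact ⟨l s t, √r, √r, h1, by linarith, by ring, by rw [hsq, ← hr']; ring,
          fun h => absurd h0 h, fun _ => hc⟩
      · have hrk := (hk s t h).1 h0
        have hr' : l s t * l t s = 4 * Real.cos (Real.pi / M s t) ^ 2 := by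
          rw [hkl] at hrk; exact_mod_cast hrk
        have hm : 3 ≤ M s t := by
          have := two_le_of_ne M hst h0
          have := h.2
          lia
        have hm' : (2 : ℝ) < M s t := by exact_mod_cast hm
        have hcos : 0 < Real.cos (Real.pi / M s t) := by
          have : 0 < Real.pi / M s t := div_pos Real.pi_pos (by linarith)
          exact Real.cos_pos_of_mem_Ioo ⟨by linarith [Real.pi_pos],
            div_lt_div_of_pos_left Real.pi_pos two_pos hm'⟩
        exact ⟨l s t, 2 * Real.cos (Real.pi / M s t), 2 * Real.cos (Real.pi / M s t), h1,
          by linarith, by ring, by linear_combination hr', fun _ => rfl, fun h => absurd h h0⟩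
    · have hM : M s t = 2 := by
        by_contra hne
        exact h ⟨hst, hne⟩
      have h' : ¬(coxeterGraph M).Adj t s := fun h' => h h'.symm
      refine ⟨1, 1, 0, one_pos, one_pos, ?_, ?_, fun _ => ?_, fun h0 => ?_⟩
      · simp [moveMatrix, hst.symm, h]
      · simp [moveMatrix, hst, h']
      · simp [hM]
      · simp [hM] at h0

/-- The complex position `p` with `J p = q`. -/
noncomputable def unscale (f : LegalWeight M) (o : Origins M) (q : S → ℝ) : S → ℂ :=
  fun s => (vertexWeight f o s)⁻¹ * q s

theorem vertexWeight_mul_unscale (f : LegalWeight M) (o : Origins M) (q : S → ℝ) (s : S) :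
    vertexWeight f o s * unscale f o q s = q s :=
  mul_inv_cancel_left₀ (vertexWeight_ne_zero f o s) _

theorem unscale_injective (f : LegalWeight M) (o : Origins M) :
    Function.Injective (unscale f o) := by
  intro q q' h
  funext s
  have h1 := vertexWeight_mul_unscale f o q s
  rw [h, vertexWeight_mul_unscale] at h1
  exact_mod_cast h1.symm

theorem fire_unscale {k : S → S → ℂ} {f : LegalWeight M} {l : S → S → ℝ}
    (hkfl : IsDecomposition k f l) (hf : IsBalanced f) (o : Origins M) (q : S → ℝ) (s : S) :
    fire M k (unscale f o q) s = unscale f o (realFire (moveMatrix M l) s q) := by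
  funext t
  simp only [fire, unscale, realFire, moveMatrix]
  split_ifs with h1 h2
  · subst h1
    push_cast
    ring
  · rw [(hkfl s t h2).2, vertexWeight_eq_mul hf o h2]
    have hs := f.ne_zero s t h2
    have ht := vertexWeight_ne_zero f o t
    push_cast
    field_simp
  · simp

theorem play_unscale {k : S → S → ℂ} {f : LegalWeight M} {l : S → S → ℝ}
    (hkfl : IsDecomposition k f l) (hf : IsBalanced f) (o : Origins M) (q : S → ℝ)
    (word : List S) : play M k (unscale f o q) word =
      unscale f o (word.foldl (fun r s => realFire (moveMatrix M l) s r) q) := by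
  induction word generalizing q with
  | nil => rfl
  | cons s word ih =>
    rw [List.foldl_cons, ← ih, ← fire_unscale hkfl hf]
    rfl

theorem isPosReal_ofReal {x : ℝ} : IsPosReal (x : ℂ) ↔ 0 < x :=
  ⟨fun ⟨r, hr, h⟩ => by rwa [Complex.ofReal_inj.1 h], fun h => ⟨x, h, rfl⟩⟩

theorem isNegReal_ofReal {x : ℝ} : IsNegReal (x : ℂ) ↔ x < 0 :=
  ⟨fun ⟨r, hr, h⟩ => by rwa [Complex.ofReal_inj.1 h], fun h => ⟨x, h, rfl⟩⟩

theorem isPseudoPositive_iff {W : Type*} [Group W] (cs : CoxeterSystem M W) {k : S → S → ℂ}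
    {f : LegalWeight M} {l : S → S → ℝ} (hkfl : IsDecomposition k f l) (hf : IsBalanced f)
    (o : Origins M) (hC : IsMoveMatrix M (moveMatrix M l)) {q : S → ℝ} (hq : ∀ s, 0 < q s)
    (word : List S) (w : W) :
    IsPseudoPositive k f o (unscale f o (realPos cs hC q w)) word ↔
      cs.length (w * cs.wordProd word) = cs.length w + word.length := by
  induction word generalizing w with
  | nil => simp [IsPseudoPositive]
  | cons s word ih =>
    rw [IsPseudoPositive, vertexWeight_mul_unscale, isPosReal_ofReal, fire_unscale hkfl hf,
      ← realPos_mul_simple, ih, realPos_pos_iff cs hC hq, cs.not_isRightDescent_iff,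
      cs.wordProd_cons, ← mul_assoc, List.length_cons]
    -- Each letter adds at most one to the length, so the total is maximal only if every step
    -- lengthens.
    have h1 := cs.length_mul_le (w * cs.simple s) (cs.wordProd word)
    have h2 := cs.length_wordProd_le word
    have h3 := cs.length_mul_simple w s
    constructor
    · rintro ⟨h4, h5⟩
      lia
    · intro h4
      constructor <;> lia

end Transfer

end WeightedCoxeter

theorem mainTheorem5 {S W : Type*} [Fintype S] [DecidableEq S] [Group W] (M : CoxeterMatrix S)
    (cs : CoxeterSystem M W) (k : S → S → ℂ) (f : WeightedCoxeter.LegalWeight M) (l : S → S → ℝ)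
    (hk : WeightedCoxeter.IsGameWeight M k) (hkfl : WeightedCoxeter.IsDecomposition k f l)
    (hf : WeightedCoxeter.IsBalanced f) (o : WeightedCoxeter.Origins M) (p : S → ℂ)
    (hp : ∀ s, WeightedCoxeter.IsPosReal ((WeightedCoxeter.weightMatrix f o).mulVec p s)) :
    (∀ word word' : List S,
      WeightedCoxeter.play M k p word = WeightedCoxeter.play M k p word' ↔
        cs.wordProd word = cs.wordProd word') ∧
    (∃ pos : W → S → ℂ,
      (∀ word : List S, pos (cs.wordProd word) = WeightedCoxeter.play M k p word) ∧
      Set.BijOn pos Set.univ (WeightedCoxeter.reachablePositions M k p) ∧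
      (∀ w : W, {s : S | cs.IsRightDescent w s} =
        {s : S | WeightedCoxeter.IsNegReal
          ((WeightedCoxeter.weightMatrix f o).mulVec (pos w) s)})) ∧
    (∀ word : List S,
      WeightedCoxeter.IsPseudoPositive k f o p word ↔ cs.IsReduced word) := by
  have hJ : ∀ (r : S → ℂ) (s : S), (WeightedCoxeter.weightMatrix f o).mulVec r s =
      WeightedCoxeter.vertexWeight f o s * r s := fun r s => Matrix.mulVec_diagonal _ _ _
  simp only [hJ] at hp ⊢
  choose q hq hpq using hp
  have hC := WeightedCoxeter.isMoveMatrix_moveMatrix hk hkfl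
  obtain rfl : p = WeightedCoxeter.unscale f o q := by
    funext s
    rw [WeightedCoxeter.unscale, ← hpq,
      inv_mul_cancel_left₀ (WeightedCoxeter.vertexWeight_ne_zero f o s)]
  have hinj : Function.Injective fun w => WeightedCoxeter.unscale f o
      (WeightedCoxeter.realPos cs hC q w) :=
    (WeightedCoxeter.unscale_injective f o).comp (WeightedCoxeter.realPos_injective cs hC hq)
  have hplay : ∀ word : List S,
      WeightedCoxeter.unscale f o (WeightedCoxeter.realPos cs hC q (cs.wordProd word)) =
        WeightedCoxeter.play M k (WeightedCoxeter.unscale f o q) word := by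
    intro word
    rw [WeightedCoxeter.play_unscale hkfl hf, ← one_mul (cs.wordProd word),
      WeightedCoxeter.realPos_mul_wordProd, WeightedCoxeter.realPos_one]
  refine ⟨fun word word' => ?_, ⟨_, hplay, ⟨?_, hinj.injOn, ?_⟩, fun w => ?_⟩, fun word => ?_⟩
  · rw [← hplay, ← hplay]
    exact hinj.eq_iff
  · intro w _
    obtain ⟨word, rfl⟩ := cs.wordProd_surjective w
    exact ⟨word, hplay word⟩
  · rintro _ ⟨word, rfl⟩
    exact ⟨cs.wordProd word, Set.mem_univ _, hplay word⟩
  · ext s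
    rw [Set.mem_ofPred_eq, Set.mem_ofPred_eq, WeightedCoxeter.vertexWeight_mul_unscale,
      WeightedCoxeter.isNegReal_ofReal, WeightedCoxeter.realPos_neg_iff cs hC hq]
  · have h := WeightedCoxeter.isPseudoPositive_iff cs hkfl hf o hC hq word 1
    rwa [WeightedCoxeter.realPos_one, one_mul, cs.length_one, zero_add] at h
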